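/- Let $G=(V,E)$ be a finite simple graph with nonempty vertex set and without isolated vertices. For $A\subseteq E$ let $\operatorname{rank}(A)$ be the rank of $A$ in the cycle matroid of $G$, that is, the maximal size of a subset of $A$ that contains no cycle, and for nonempty $A$ let $\rho(A):=|A|/\operatorname{rank}(A)$; write $\rho(G):=\rho(E)$. Suppose that $G$ is uniformly dense, i.e. $\rho(A)\le\rho(E)$ for all nonempty $A\subseteq E$. Let $c(G)$ be the number of connected components of $G$, and let $\lambda_{\max}(G)$ be the largest eigenvalue of the normalized Laplacian of $G$, the linear operator $L$ on functions $f:V\to\mathbb{R}$ given by $Lf(v):=f(v)-\frac{1}{\deg(v)}\sum_{u:\{u,v\}\in E}f(u)$. Then $$\lambda_{\max}(G)\;\ge\;2\,\rho(G)^{-1}+2\cdot\frac{\left(\lfloor\rho(G)\rfloor-1\right)c(G)}{|E|}.$$ -/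

import Mathlib

/-! ### Density of finite matroids -/

/-- The density `ρ(A) = |A| / rank(A)` of a set `A` in a matroid `M`. -/
noncomputable def matroidDensity {α : Type*} (M : Matroid α) (A : Set α) : ℝ :=
  (A.ncard : ℝ) / ((M.eRk A).toNat : ℝ)

/-- A (finite, loopless) matroid `M` on the ground set `E` is uniformly dense if
`ρ(A) ≤ ρ(E)` for all nonempty `A ⊆ E`. -/
def IsUniformlyDenseMatroid {α : Type*} (M : Matroid α) : Prop :=
  ∀ A : Set α, A ⊆ M.E → A.Nonempty → matroidDensity M A ≤ matroidDensity M M.E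

/-! ### The cycle matroid of a finite simple graph -/

/-- Reachability after adding the edge `uv`. -/
theorem reachable_sup_edge_cases {V : Type*} {F : SimpleGraph V} {u v a b : V}
    (h : (F ⊔ SimpleGraph.fromEdgeSet {s(u, v)}).Reachable a b) :
    F.Reachable a b ∨ (F.Reachable a u ∧ F.Reachable v b) ∨
      (F.Reachable a v ∧ F.Reachable u b) := by
  obtain ⟨p⟩ := h
  induction p with
  | nil => exact Or.inl (SimpleGraph.Reachable.refl _)
  | @cons x y z hxy _ ih =>
    rcases hxy with hxy | hxy
    · have h1 : F.Reachable x y := hxy.reachable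
      rcases ih with h | ⟨h, h'⟩ | ⟨h, h'⟩
      · exact Or.inl (h1.trans h)
      · exact Or.inr (Or.inl ⟨h1.trans h, h'⟩)
      · exact Or.inr (Or.inr ⟨h1.trans h, h'⟩)
    · have h2 := (SimpleGraph.fromEdgeSet_adj _).1 hxy
      have h3 : s(x, y) = s(u, v) := h2.1
      rcases Sym2.eq_iff.1 h3 with ⟨rfl, rfl⟩ | ⟨rfl, rfl⟩
      · rcases ih with h | ⟨_, h'⟩ | ⟨_, h'⟩
        · exact Or.inr (Or.inl ⟨SimpleGraph.Reachable.refl _, h⟩)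
        · exact Or.inr (Or.inl ⟨SimpleGraph.Reachable.refl _, h'⟩)
        · exact Or.inl h'
      · rcases ih with h | ⟨_, h'⟩ | ⟨_, h'⟩
        · exact Or.inr (Or.inr ⟨SimpleGraph.Reachable.refl _, h⟩)
        · exact Or.inl h'
        · exact Or.inr (Or.inr ⟨SimpleGraph.Reachable.refl _, h'⟩)

/-- Adding an edge between two components lowers the number of components by one. -/
theorem card_components_sup_edge {V : Type*} [Finite V] {F : SimpleGraph V} {u v : V}
    (h : ¬ F.Reachable u v) :
    Nat.card (F ⊔ SimpleGraph.fromEdgeSet {s(u, v)}).ConnectedComponent + 1 =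
      Nat.card F.ConnectedComponent := by
  classical
  have huv : u ≠ v := fun e => h (e ▸ SimpleGraph.Reachable.refl _)
  set F' := F ⊔ SimpleGraph.fromEdgeSet {s(u, v)} with hF'
  have hle : F ≤ F' := le_sup_left
  have hadj : F'.Reachable u v := by
    apply SimpleGraph.Adj.reachable
    exact Or.inr ((SimpleGraph.fromEdgeSet_adj _).2 ⟨rfl, huv⟩)
  let φ : {c : F.ConnectedComponent // c ≠ F.connectedComponentMk u} → F'.ConnectedComponent :=
    fun c => c.1.map (SimpleGraph.Hom.ofLE hle)
  have hφ : Function.Bijective φ := by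
    constructor
    · rintro ⟨c, hc⟩ ⟨d, hd⟩ hcd
      induction c using SimpleGraph.ConnectedComponent.ind with | _ a => ?_
      induction d using SimpleGraph.ConnectedComponent.ind with | _ b => ?_
      have hab : F'.Reachable a b := SimpleGraph.ConnectedComponent.exact hcd
      rcases reachable_sup_edge_cases hab with h1 | ⟨h1, _⟩ | ⟨_, h1⟩
      · exact Subtype.ext (SimpleGraph.ConnectedComponent.sound h1)
      · exact absurd (SimpleGraph.ConnectedComponent.sound h1) hc
      · exact absurd (SimpleGraph.ConnectedComponent.sound h1.symm) hd
    · intro c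
      induction c using SimpleGraph.ConnectedComponent.ind with | _ a => ?_
      by_cases ha : F.Reachable a u
      · refine ⟨⟨F.connectedComponentMk v,
          fun e => h (SimpleGraph.ConnectedComponent.exact e).symm⟩, ?_⟩
        exact SimpleGraph.ConnectedComponent.sound (((ha.mono hle).trans hadj).symm)
      · exact ⟨⟨F.connectedComponentMk a,
          fun e => ha (SimpleGraph.ConnectedComponent.exact e)⟩, rfl⟩
  rw [← Nat.card_congr (Equiv.ofBijective φ hφ)]
  have := Fintype.ofFinite F.ConnectedComponent
  rw [Nat.card_eq_fintype_card, Nat.card_eq_fintype_card, Fintype.card_subtype_compl,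
    Fintype.card_subtype_eq]
  have : 0 < Fintype.card F.ConnectedComponent :=
    Fintype.card_pos_iff.2 ⟨F.connectedComponentMk u⟩
  omega

/-- A forest with edge set `A` has `|V| - |A|` components. -/
theorem ncard_add_card_components {V : Type*} [Finite V] (A : Set (Sym2 V))
    (hA : ∀ e ∈ A, ¬ e.IsDiag) (h : (SimpleGraph.fromEdgeSet A).IsAcyclic) :
    A.ncard + Nat.card (SimpleGraph.fromEdgeSet A).ConnectedComponent = Nat.card V := by
  induction A, A.toFinite using Set.Finite.induction_on with
  | empty =>
    rw [Set.ncard_empty, zero_add]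
    refine (Nat.card_congr (Equiv.ofBijective
      (SimpleGraph.fromEdgeSet (∅ : Set (Sym2 V))).connectedComponentMk ⟨?_, ?_⟩)).symm
    · intro a b hab
      have := SimpleGraph.ConnectedComponent.exact hab
      rwa [SimpleGraph.fromEdgeSet_empty, SimpleGraph.reachable_bot] at this
    · intro c
      induction c using SimpleGraph.ConnectedComponent.ind with | _ a => exact ⟨a, rfl⟩
  | @insert e A he _ ih =>
    induction e using Sym2.ind with | _ u v => ?_
    have hne : u ≠ v := fun e => hA s(u, v) (Set.mem_insert _ _) (by simpa using e)
    have heq : SimpleGraph.fromEdgeSet (insert s(u, v) A) =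
        SimpleGraph.fromEdgeSet A ⊔ SimpleGraph.fromEdgeSet {s(u, v)} := by
      rw [← SimpleGraph.fromEdgeSet_union, Set.union_comm, Set.insert_eq]
    have hac : (SimpleGraph.fromEdgeSet A).IsAcyclic :=
      h.anti (SimpleGraph.fromEdgeSet_mono (Set.subset_insert _ _))
    have hnr : ¬ (SimpleGraph.fromEdgeSet A).Reachable u v := by
      intro hr
      rw [heq] at h
      change (SimpleGraph.fromEdgeSet A ⊔ SimpleGraph.edge u v).IsAcyclic at h
      rw [SimpleGraph.isAcyclic_sup_fromEdgeSet_iff] at h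
      rcases h.2 hr with h' | h'
      · exact hne h'
      · exact he ((SimpleGraph.fromEdgeSet_adj _).1 h').1
    have h1 := ih (fun e he => hA e (Set.mem_insert_of_mem _ he)) hac
    have h2 := card_components_sup_edge hnr
    rw [Set.ncard_insert_of_notMem he, heq]
    omega

/-- The cycle matroid `M(G)` of a finite simple graph `G`: its ground set is the edge set of `G`,
its independent sets are the sets of edges that contain no cycle. Hence its bases, the maximal
independent sets, are the spanning trees (maximal spanning forests) of `G`. -/
def cycleMatroid {V : Type*} [Finite V] (G : SimpleGraph V) : Matroid (Sym2 V) :=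
  (IndepMatroid.ofFinite (E := G.edgeSet) (Set.toFinite _)
    (fun A => A ⊆ G.edgeSet ∧ (SimpleGraph.fromEdgeSet A).IsAcyclic)
    ⟨Set.empty_subset _, by rw [SimpleGraph.fromEdgeSet_empty]; exact SimpleGraph.isAcyclic_bot⟩
    (fun _ _ hJ hIJ => ⟨hIJ.trans hJ.1, hJ.2.anti (SimpleGraph.fromEdgeSet_mono hIJ)⟩)
    (by
      intro I J hI hJ hlt
      by_contra! hcon
      have hdiag : ∀ A : Set (Sym2 V), A ⊆ G.edgeSet → ∀ e ∈ A, ¬ e.IsDiag :=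
        fun A hA e he => G.not_isDiag_of_mem_edgeSet (hA he)
      have hadj : ∀ a b, (SimpleGraph.fromEdgeSet J).Adj a b →
          (SimpleGraph.fromEdgeSet I).Reachable a b := by
        intro a b hab
        have hab' := (SimpleGraph.fromEdgeSet_adj _).1 hab
        by_contra hnr
        have hnI : s(a, b) ∉ I := fun hmem =>
          hnr (SimpleGraph.Adj.reachable ((SimpleGraph.fromEdgeSet_adj _).2 ⟨hmem, hab'.2⟩))
        refine hcon _ hab'.1 hnI (Set.insert_subset (hJ.1 hab'.1) hI.1) ?_
        rw [Set.insert_eq, Set.union_comm, SimpleGraph.fromEdgeSet_union]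
        change (SimpleGraph.fromEdgeSet I ⊔ SimpleGraph.edge a b).IsAcyclic
        rw [SimpleGraph.isAcyclic_sup_fromEdgeSet_iff]
        exact ⟨hI.2, fun h => absurd h hnr⟩
      have hreach : ∀ a b, (SimpleGraph.fromEdgeSet J).Reachable a b →
          (SimpleGraph.fromEdgeSet I).Reachable a b := by
        rintro a b ⟨p⟩
        induction p with
        | nil => exact SimpleGraph.Reachable.refl _
        | cons hxy _ ih => exact (hadj _ _ hxy).trans ih
      have hsurj : Function.Surjective
          (fun c : (SimpleGraph.fromEdgeSet J).ConnectedComponent =>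
            SimpleGraph.ConnectedComponent.lift
              (SimpleGraph.fromEdgeSet I).connectedComponentMk
              (fun a b p _ => SimpleGraph.ConnectedComponent.sound (hreach a b ⟨p⟩)) c) := by
        intro c
        induction c using SimpleGraph.ConnectedComponent.ind with | _ a => ?_
        exact ⟨(SimpleGraph.fromEdgeSet J).connectedComponentMk a, rfl⟩
      have h1 := Nat.card_le_card_of_surjective _ hsurj
      have h2 := ncard_add_card_components I (hdiag I hI.1) hI.2
      have h3 := ncard_add_card_components J (hdiag J hJ.1) hJ.2
      omega)
    (fun _ hI => hI.1)).matroid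

/-! ### Graphs -/

/-- The density `ρ(G) = |E| / rank(M(G))` of a graph, i.e. the density of its cycle matroid. -/
noncomputable def graphDensity {V : Type*} [Finite V] (G : SimpleGraph V) : ℝ :=
  matroidDensity (cycleMatroid G) (cycleMatroid G).E

/-- A graph is uniformly dense if its cycle matroid is. -/
def IsUniformlyDenseGraph {V : Type*} [Finite V] (G : SimpleGraph V) : Prop :=
  IsUniformlyDenseMatroid (cycleMatroid G)

/-- The number `c(G)` of connected components of a graph. -/
noncomputable def numComponents {V : Type*} (G : SimpleGraph V) : ℕ :=
  Nat.card G.ConnectedComponent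

/-- The normalized Laplacian `L f (v) = f v - (1 / deg v) * ∑_{u ~ v} f u`. -/
noncomputable def normalizedLaplacian {V : Type*} [Fintype V] (G : SimpleGraph V)
    [DecidableRel G.Adj] : (V → ℝ) →ₗ[ℝ] (V → ℝ) where
  toFun f v := f v - 1 / (G.degree v : ℝ) * ∑ u ∈ G.neighborFinset v, f u
  map_add' f g := by
    funext v
    simp only [Pi.add_apply, Finset.sum_add_distrib]
    ring
  map_smul' r f := by
    funext v
    simp only [Pi.smul_apply, smul_eq_mul, RingHom.id_apply, ← Finset.mul_sum]
    ring

/-- The largest eigenvalue of the normalized Laplacian. -/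
noncomputable def lambdaMax {V : Type*} [Fintype V] (G : SimpleGraph V)
    [DecidableRel G.Adj] : ℝ :=
  sSup {μ : ℝ | Module.End.HasEigenvalue (normalizedLaplacian G) μ}

/-! The Rayleigh quotient of a ±1 vector, taken in the degree-weighted inner product that makes the
normalized Laplacian symmetric, is twice the fraction of edges cut by its sign pattern. Since the
rank of `E` is `|V| - c(G)`, it suffices to find a cut with at least `|V| + (k - 2) c(G)` edges,
where `k = ⌊ρ(G)⌋`.

For `k ≤ 1` the bipartition of a spanning forest is enough. For `k ≥ 2` each component is treated
separately. Uniform density, applied to the complement of a component on `s + 1` vertices, forces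
that component to have at least `ρ s ≥ k s` edges. Averaging over all colorings gives a cut with
strictly more than half of them. Simplicity bounds the edge count by `(s + 1) s / 2`, so `s ≥ 2k -
1`, which makes this cut at least `s + k - 1`. Summing over the components gives the bound
(`exists_coloring_of_isUniformlyDenseGraph`). -/

/-- The spanning subgraph of `G` whose edges join vertices of different colors. -/
def cutGraph {V : Type*} (G : SimpleGraph V) (f : V → Bool) : SimpleGraph V :=
  G ⊓ (⊤ : SimpleGraph Bool).comap f

theorem cutGraph_adj {V : Type*} {G : SimpleGraph V} {f : V → Bool} {u v : V} :
    (cutGraph G f).Adj u v ↔ G.Adj u v ∧ f u ≠ f v := by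
  simp [cutGraph]

/-! ### Spectral part: Rayleigh quotients of the normalized Laplacian -/

/-- A symmetric operator has an eigenvalue at least as large as any given Rayleigh quotient. -/
theorem LinearMap.IsSymmetric.exists_hasEigenvalue_ge {E : Type*} [NormedAddCommGroup E]
    [InnerProductSpace ℝ E] [FiniteDimensional ℝ E] {T : E →ₗ[ℝ] E} (hT : T.IsSymmetric)
    {x : E} (hx : x ≠ 0) :
    ∃ μ, Module.End.HasEigenvalue T μ ∧ inner ℝ (T x) x / ‖x‖ ^ 2 ≤ μ := by
  have : Nontrivial E := ⟨x, 0, hx⟩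
  refine ⟨_, hT.hasEigenvalue_iSup_of_finiteDimensional, ?_⟩
  refine le_ciSup (f := fun x : {x : E // x ≠ 0} =>
    (RCLike.re (inner ℝ (T x) (x : E)) / ‖(x : E)‖ ^ 2 : ℝ)) ?_ ⟨x, hx⟩
  refine ⟨‖T.toContinuousLinearMap‖, ?_⟩
  rintro _ ⟨y, rfl⟩
  exact (le_abs_self _).trans (T.toContinuousLinearMap.rayleighQuotient_le_norm (y : E))

/-- The isometry from functions with the degree-weighted inner product to Euclidean space. -/
noncomputable def degreeScaling {V : Type*} [Fintype V] (G : SimpleGraph V) [DecidableRel G.Adj]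
    (h : ∀ v, 0 < G.degree v) : (V → ℝ) ≃ₗ[ℝ] EuclideanSpace ℝ V :=
  (LinearEquiv.piCongrRight fun v => LinearEquiv.smulOfNeZero ℝ ℝ (Real.sqrt (G.degree v))
    (Real.sqrt_pos.2 (Nat.cast_pos.2 (h v))).ne').trans (WithLp.linearEquiv 2 ℝ (V → ℝ)).symm

section
variable {V : Type*} [Fintype V] (G : SimpleGraph V) [DecidableRel G.Adj]

theorem inner_degreeScaling (h : ∀ v, 0 < G.degree v) (f g : V → ℝ) :
    inner ℝ (degreeScaling G h f) (degreeScaling G h g) = ∑ v, (G.degree v : ℝ) * (f v * g v) := by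
  rw [PiLp.inner_apply]
  refine Finset.sum_congr rfl fun v _ => ?_
  have : (Real.sqrt (G.degree v)) * Real.sqrt (G.degree v) = G.degree v :=
    Real.mul_self_sqrt (Nat.cast_nonneg _)
  change (Real.sqrt (G.degree v) * g v) * (Real.sqrt (G.degree v) * f v) = _
  linear_combination f v * g v * this

theorem inner_degreeScaling_normalizedLaplacian (h : ∀ v, 0 < G.degree v) (f g : V → ℝ) :
    inner ℝ (degreeScaling G h (normalizedLaplacian G f)) (degreeScaling G h g) =
      ∑ v, (G.degree v : ℝ) * (f v * g v) - ∑ v, ∑ u, if G.Adj v u then f u * g v else 0 := by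
  rw [inner_degreeScaling, ← Finset.sum_sub_distrib]
  refine Finset.sum_congr rfl fun v _ => ?_
  have hv : (G.degree v : ℝ) ≠ 0 := Nat.cast_ne_zero.2 (h v).ne'
  have h1 : (∑ u, if G.Adj v u then f u * g v else 0) =
      (∑ u ∈ G.neighborFinset v, f u) * g v := by
    rw [← Finset.sum_filter, Finset.sum_mul]
    refine Finset.sum_congr ?_ fun _ _ => rfl
    ext u
    simp
  rw [h1]
  change (G.degree v : ℝ) * ((f v - 1 / (G.degree v : ℝ) * ∑ u ∈ G.neighborFinset v, f u) * g v) = _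
  field_simp

/-- The normalized Laplacian is self-adjoint only for the degree-weighted inner product; conjugation
moves it to the standard Euclidean one without changing eigenvalues. -/
theorem isSymmetric_conj_normalizedLaplacian (h : ∀ v, 0 < G.degree v) :
    ((degreeScaling G h).conj (normalizedLaplacian G)).IsSymmetric := by
  intro x y
  obtain ⟨f, rfl⟩ := (degreeScaling G h).surjective x
  obtain ⟨g, rfl⟩ := (degreeScaling G h).surjective y
  rw [LinearEquiv.conj_apply_apply, LinearEquiv.conj_apply_apply, LinearEquiv.symm_apply_apply,
    LinearEquiv.symm_apply_apply, real_inner_comm (degreeScaling G h (normalizedLaplacian G g)),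
    inner_degreeScaling_normalizedLaplacian, inner_degreeScaling_normalizedLaplacian]
  congr 1
  · exact Finset.sum_congr rfl fun v _ => by ring
  · rw [Finset.sum_comm]
    refine Finset.sum_congr rfl fun v _ => Finset.sum_congr rfl fun u _ => ?_
    simp only [G.adj_comm u v, mul_comm]

theorem hasEigenvalue_of_hasEigenvalue_conj {K M N : Type*} [Field K] [AddCommGroup M]
    [AddCommGroup N] [Module K M] [Module K N] (e : M ≃ₗ[K] N) {T : Module.End K M} {μ : K}
    (h : Module.End.HasEigenvalue (e.conj T) μ) : Module.End.HasEigenvalue T μ := by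
  obtain ⟨x, hx⟩ := h.exists_hasEigenvector
  obtain ⟨y, rfl⟩ := e.surjective x
  refine Module.End.hasEigenvalue_of_hasEigenvector (x := y)
    (Module.End.hasEigenvector_iff.2 ⟨Module.End.mem_eigenspace_iff.2 ?_, ?_⟩)
  · have := hx.apply_eq_smul
    rw [LinearEquiv.conj_apply_apply, LinearEquiv.symm_apply_apply, ← map_smul] at this
    exact e.injective this
  · rintro rfl
    exact hx.2 (map_zero e)

/-- The set of eigenvalues is finite, so once it is nonempty its `sSup` is attained; a real `sSup`
of the empty set would be the default value 0. -/
theorem isGreatest_lambdaMax {μ : ℝ}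
    (h : Module.End.HasEigenvalue (normalizedLaplacian G) μ) :
    IsGreatest {μ : ℝ | Module.End.HasEigenvalue (normalizedLaplacian G) μ} (lambdaMax G) := by
  have hfin : {μ : ℝ | Module.End.HasEigenvalue (normalizedLaplacian G) μ}.Finite :=
    Module.End.finite_hasEigenvalue _
  exact ⟨Set.Nonempty.csSup_mem ⟨μ, h⟩ hfin, fun ν hν => le_csSup hfin.bddAbove hν⟩

theorem exists_hasEigenvalue_ge_cut [Nonempty V] (h : ∀ v, 0 < G.degree v) (f : V → Bool) :
    ∃ μ, Module.End.HasEigenvalue (normalizedLaplacian G) μ ∧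
      2 * ((cutGraph G f).edgeSet.ncard : ℝ) / (G.edgeSet.ncard : ℝ) ≤ μ := by
  classical
  let s : V → ℝ := fun v => if f v then 1 else -1
  have hs : ∀ v, s v * s v = 1 := fun v => by
    by_cases hv : f v = true <;> simp [s, hv]
  have hs0 : s ≠ 0 := fun h0 => by
    have := hs (Classical.arbitrary V)
    simp [h0] at this
  have hncard : ∀ (H : SimpleGraph V) [DecidableRel H.Adj],
      (∑ v, (H.degree v : ℝ)) = 2 * (H.edgeSet.ncard : ℝ) := fun H _ => by
    rw [← SimpleGraph.coe_edgeFinset, Set.ncard_coe_finset]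
    exact_mod_cast H.sum_degrees_eq_twice_card_edges
  have hx : degreeScaling G h s ≠ 0 := (LinearEquiv.map_ne_zero_iff _).2 hs0
  obtain ⟨μ, hμ, hle⟩ := (isSymmetric_conj_normalizedLaplacian G h).exists_hasEigenvalue_ge hx
  refine ⟨μ, hasEigenvalue_of_hasEigenvalue_conj _ hμ, le_trans (le_of_eq ?_) hle⟩
  rw [LinearEquiv.conj_apply_apply, LinearEquiv.symm_apply_apply, ← real_inner_self_eq_norm_sq,
    inner_degreeScaling_normalizedLaplacian, inner_degreeScaling]
  have hdeg : ∀ (H : SimpleGraph V) [DecidableRel H.Adj] (v : V),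
      (H.degree v : ℝ) = ∑ u, if H.Adj v u then 1 else 0 := fun H _ v => by
    rw [Finset.sum_boole, ← SimpleGraph.card_neighborFinset_eq_degree]
    congr 2
    ext u
    simp
  -- An ordered adjacent pair contributes `1 - s u * s v`, which is 2 across the cut and 0
  -- otherwise. By the handshake lemma the quotient is then 4 times the cut size over `2|E|`.
  have hnum : (∑ v, (G.degree v : ℝ) * (s v * s v)) -
      (∑ v, ∑ u, if G.Adj v u then s u * s v else 0) =
        2 * ∑ v, ((cutGraph G f).degree v : ℝ) := by
    rw [← Finset.sum_sub_distrib, Finset.mul_sum]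
    refine Finset.sum_congr rfl fun v _ => ?_
    rw [hs, mul_one, hdeg, hdeg, ← Finset.sum_sub_distrib, Finset.mul_sum]
    refine Finset.sum_congr rfl fun u _ => ?_
    simp only [cutGraph_adj, s]
    by_cases huv : G.Adj v u <;> cases f u <;> cases f v <;> simp [huv] <;> norm_num
  rw [hnum, hncard]
  simp only [hs, mul_one]
  rw [hncard, mul_div_mul_left _ _ two_ne_zero]

end

/-! ### Rank and components in the cycle matroid -/

section
variable {V : Type*} [Finite V] (G : SimpleGraph V)

/-- The rank of a set of edges is attained by a forest. -/
theorem exists_forest_ncard_eq_rank (A : Set (Sym2 V)) :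
    ∃ I ⊆ A, I ⊆ G.edgeSet ∧ (SimpleGraph.fromEdgeSet I).IsAcyclic ∧
      ((cycleMatroid G).eRk A).toNat = I.ncard := by
  obtain ⟨I, hI⟩ := (cycleMatroid G).exists_isBasis' A
  exact ⟨I, hI.subset, hI.indep.1, hI.indep.2, by rw [hI.eRk_eq_encard]; rfl⟩

theorem ncard_le_rank {A I : Set (Sym2 V)} (hIA : I ⊆ A) (hI : (cycleMatroid G).Indep I) :
    I.ncard ≤ ((cycleMatroid G).eRk A).toNat := by
  have h1 := hI.encard_le_eRk_of_subset hIA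
  obtain ⟨J, hJ⟩ := (cycleMatroid G).exists_isBasis' A
  -- `toNat` sends `⊤` to 0, so monotonicity needs the larger rank to be finite.
  refine ENat.toNat_le_toNat h1 ?_
  rw [hJ.eRk_eq_encard]
  exact (Set.toFinite J).encard_lt_top.ne

/-- A spanning forest. -/
theorem exists_spanning_forest : ∃ F : Set (Sym2 V), F ⊆ G.edgeSet ∧
    (SimpleGraph.fromEdgeSet F).IsAcyclic ∧ F.ncard + numComponents G = Nat.card V := by
  obtain ⟨F, hF, hac, hr⟩ := G.exists_isAcyclic_reachable_eq_le
  refine ⟨F.edgeSet, SimpleGraph.edgeSet_mono hF, by rwa [SimpleGraph.fromEdgeSet_edgeSet], ?_⟩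
  rw [← ncard_add_card_components F.edgeSet (fun e he => F.not_isDiag_of_mem_edgeSet he)
    (by rwa [SimpleGraph.fromEdgeSet_edgeSet]), SimpleGraph.fromEdgeSet_edgeSet]
  congr 1
  unfold numComponents SimpleGraph.ConnectedComponent
  rw [hr]

theorem reachable_of_reachable_fromEdgeSet {V : Type*} (G : SimpleGraph V) {I : Set (Sym2 V)} (hI : I ⊆ G.edgeSet) {a b : V}
    (h : (SimpleGraph.fromEdgeSet I).Reachable a b) : G.Reachable a b :=
  h.mono (by
    rw [← G.fromEdgeSet_edgeSet]
    exact SimpleGraph.fromEdgeSet_mono hI)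

/-- A set of edges avoiding the component `C` leaves each vertex of `C` isolated. -/
theorem ncard_supp_add_numComponents_le {I : Set (Sym2 V)} (hI : I ⊆ G.edgeSet)
    (C : G.ConnectedComponent) (hC : ∀ u v, s(u, v) ∈ I → u ∉ C.supp) :
    C.supp.ncard + numComponents G ≤
      Nat.card (SimpleGraph.fromEdgeSet I).ConnectedComponent + 1 := by
  classical
  -- The vertices of `C` are isolated for `I`, and every other component of `G` supplies a
  -- representative; all of these lie in distinct components of `I`. The `+ 1` in the bound accounts
  -- for `C` itself.
  let φ : C.supp ⊕ {D : G.ConnectedComponent // D ≠ C} →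
      (SimpleGraph.fromEdgeSet I).ConnectedComponent :=
    Sum.elim (fun v => (SimpleGraph.fromEdgeSet I).connectedComponentMk v.1)
      (fun D => (SimpleGraph.fromEdgeSet I).connectedComponentMk D.1.out)
  have hout : ∀ D : G.ConnectedComponent, G.connectedComponentMk D.out = D := Quot.out_eq
  have hiso : ∀ a b, a ∈ C.supp → (SimpleGraph.fromEdgeSet I).Reachable a b → a = b := by
    rintro a b ha ⟨p⟩
    cases p with
    | nil => rfl
    | cons hadj _ => exact absurd ha (hC _ _ ((SimpleGraph.fromEdgeSet_adj _).1 hadj).1)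
  have hφ : Function.Injective φ := by
    rintro (⟨a, ha⟩ | ⟨D, hD⟩) (⟨b, hb⟩ | ⟨D', hD'⟩) hab
    · have := hiso a b ha (SimpleGraph.ConnectedComponent.exact hab)
      subst this
      rfl
    · refine absurd ?_ hD'
      have := hiso a _ ha (SimpleGraph.ConnectedComponent.exact hab)
      rw [← hout D', ← this]
      exact ha
    · refine absurd ?_ hD
      have := hiso b _ hb (SimpleGraph.ConnectedComponent.exact hab).symm
      rw [← hout D, ← this]
      exact hb
    · have h1 := reachable_of_reachable_fromEdgeSet G hI (SimpleGraph.ConnectedComponent.exact hab)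
      have h2 := SimpleGraph.ConnectedComponent.sound h1
      rw [hout, hout] at h2
      subst h2
      rfl
  have h1 := Nat.card_le_card_of_injective φ hφ
  have : Fintype G.ConnectedComponent := Fintype.ofFinite _
  have h2 : Nat.card {D : G.ConnectedComponent // D ≠ C} + 1 = numComponents G := by
    rw [numComponents, Nat.card_eq_fintype_card, Nat.card_eq_fintype_card,
      Fintype.card_subtype_compl, Fintype.card_subtype_eq]
    exact Nat.sub_add_cancel (Fintype.card_pos_iff.2 ⟨C⟩)
  rw [Nat.card_sum, Nat.card_coe_set_eq] at h1
  omega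

theorem rank_edgeSet_add_numComponents :
    ((cycleMatroid G).eRk G.edgeSet).toNat + numComponents G = Nat.card V := by
  apply le_antisymm
  · obtain ⟨I, -, hI, hac, h⟩ := exists_forest_ncard_eq_rank G G.edgeSet
    rw [h, ← ncard_add_card_components I (fun e he => G.not_isDiag_of_mem_edgeSet (hI he)) hac]
    refine Nat.add_le_add_left (Nat.card_le_card_of_surjective (SimpleGraph.ConnectedComponent.map
      (SimpleGraph.Hom.ofLE (?_ : SimpleGraph.fromEdgeSet I ≤ G))) ?_) _
    · rw [← G.fromEdgeSet_edgeSet]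
      exact SimpleGraph.fromEdgeSet_mono hI
    · intro c
      induction c using SimpleGraph.ConnectedComponent.ind with | _ a => ?_
      exact ⟨SimpleGraph.connectedComponentMk _ a, rfl⟩
  · obtain ⟨F, hF, hac, h⟩ := exists_spanning_forest G
    rw [← h]
    exact Nat.add_le_add_right (ncard_le_rank G hF ⟨hF, hac⟩) _

theorem cycleMatroid_rank_pos {A : Set (Sym2 V)} (hA : A ⊆ G.edgeSet) (hne : A.Nonempty) :
    0 < ((cycleMatroid G).eRk A).toNat := by
  obtain ⟨e, he⟩ := hne
  have : (cycleMatroid G).Indep {e} := by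
    refine ⟨Set.singleton_subset_iff.2 (hA he), ?_⟩
    induction e using Sym2.ind with | _ u v => ?_
    have hac : (⊥ ⊔ SimpleGraph.edge u v : SimpleGraph V).IsAcyclic := by
      rw [SimpleGraph.isAcyclic_sup_fromEdgeSet_iff]
      exact ⟨SimpleGraph.isAcyclic_bot, fun h => Or.inl (SimpleGraph.reachable_bot.1 h)⟩
    rwa [bot_sup_eq] at hac
  have h := ncard_le_rank G (Set.singleton_subset_iff.2 he) this
  rw [Set.ncard_singleton] at h
  exact h

/-- The density inequality cleared of its denominator, which also covers the empty set. -/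
theorem IsUniformlyDenseGraph.ncard_le {G : SimpleGraph V} (hG : IsUniformlyDenseGraph G)
    {A : Set (Sym2 V)} (hA : A ⊆ G.edgeSet) :
    (A.ncard : ℝ) ≤ graphDensity G * (((cycleMatroid G).eRk A).toNat : ℝ) := by
  rcases A.eq_empty_or_nonempty with rfl | hne
  · simp
  · exact (div_le_iff₀ (Nat.cast_pos.2 (cycleMatroid_rank_pos G hA hne))).1 (hG A hA hne)

/-! ### Edge counts of the components -/

/-- The edges of `G` in the component `C`. -/
def componentEdges {V : Type*} (G : SimpleGraph V) (C : G.ConnectedComponent) : Set (Sym2 V) :=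
  {e ∈ G.edgeSet | ∀ v ∈ e, v ∈ C.supp}

theorem mk_mem_componentEdges {V : Type*} {G : SimpleGraph V} {C : G.ConnectedComponent} {u v : V} :
    s(u, v) ∈ componentEdges G C ↔ G.Adj u v ∧ u ∈ C.supp := by
  constructor
  · exact fun h => ⟨h.1, h.2 u (Sym2.mem_mk_left u v)⟩
  · refine fun h => ⟨h.1, fun w hw => ?_⟩
    rcases Sym2.mem_iff.1 hw with rfl | rfl
    · exact h.2
    · exact (SimpleGraph.ConnectedComponent.sound h.1.reachable.symm).trans h.2

/-- Each component of a uniformly dense graph has at least the density of the graph. -/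
theorem IsUniformlyDenseGraph.le_ncard_componentEdges {G : SimpleGraph V}
    (hG : IsUniformlyDenseGraph G) (hne : G.edgeSet.Nonempty) (C : G.ConnectedComponent) :
    graphDensity G * ((C.supp.ncard : ℝ) - 1) ≤ ((componentEdges G C).ncard : ℝ) := by
  have hsub : componentEdges G C ⊆ G.edgeSet := fun e he => he.1
  -- Density bounds sets from above, so a lower bound for `C` comes from the edges outside it.
  have h1 := hG.ncard_le (A := G.edgeSet \ componentEdges G C) Set.sdiff_subset
  have h2 := Set.ncard_sdiff_add_ncard_of_subset hsub
  have hm : (G.edgeSet.ncard : ℝ) =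
      graphDensity G * (((cycleMatroid G).eRk G.edgeSet).toNat : ℝ) :=
    (div_mul_cancel₀ _ (Nat.cast_pos.2 (cycleMatroid_rank_pos G subset_rfl hne)).ne').symm
  have hr := rank_edgeSet_add_numComponents G
  obtain ⟨I, hIA, hI, hac, h⟩ :=
    exists_forest_ncard_eq_rank G (G.edgeSet \ componentEdges G C)
  have h3 := ncard_add_card_components I (fun e he => G.not_isDiag_of_mem_edgeSet (hI he)) hac
  have h4 := ncard_supp_add_numComponents_le G hI C fun u v huv hu =>
    (hIA huv).2 (mk_mem_componentEdges.2 ⟨hI huv, hu⟩)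
  -- Deleting the edges of `C` lowers the rank by at least `|C| - 1`.
  have h5 : (((cycleMatroid G).eRk (G.edgeSet \ componentEdges G C)).toNat : ℝ) +
      C.supp.ncard ≤ ((cycleMatroid G).eRk G.edgeSet).toNat + 1 := by
    exact_mod_cast (by omega)
  have h0 : 0 ≤ graphDensity G := div_nonneg (Nat.cast_nonneg _) (Nat.cast_nonneg _)
  have h6 := mul_le_mul_of_nonneg_left h5 h0
  have h2' : ((G.edgeSet \ componentEdges G C).ncard : ℝ) + (componentEdges G C).ncard =
    G.edgeSet.ncard := by exact_mod_cast h2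
  linarith

theorem ncard_componentEdges_le {V : Type*} [Finite V] (G : SimpleGraph V)
    (C : G.ConnectedComponent) : (componentEdges G C).ncard ≤ C.supp.ncard.choose 2 := by
  classical
  have := Fintype.ofFinite V
  rw [Set.ncard_eq_toFinset_card' C.supp, ← Sym2.card_image_offDiag, ← Set.ncard_coe_finset]
  refine Set.ncard_le_ncard (fun e he => ?_) (Set.toFinite _)
  induction e using Sym2.ind with | _ u v => ?_
  rw [Finset.mem_coe, Finset.mem_image]
  exact ⟨(u, v), by simpa using ⟨he.2 u (by simp), he.2 v (by simp), G.ne_of_adj he.1⟩, rfl⟩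

/-! ### Large cuts -/

/-- Some cut contains more than half of any given nonempty set of edges. -/
theorem exists_coloring_lt_two_mul_ncard {S : Set (Sym2 V)} (hS : ∀ e ∈ S, ¬ e.IsDiag)
    (hne : S.Nonempty) :
    ∃ f : V → Bool, S.ncard < 2 * {e ∈ S | ¬ (e.map f).IsDiag}.ncard := by
  classical
  have := Fintype.ofFinite V
  set T := S.toFinset with hT
  have hTne : T.Nonempty := by simpa [hT] using hne
  let w : (V → Bool) → Sym2 V → ℤ := fun f e => if (e.map f).IsDiag then 1 else -1
  have hsum : ∑ f, ∑ e ∈ T, w f e = 0 := by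
    rw [Finset.sum_comm]
    refine Finset.sum_eq_zero fun e he => ?_
    have hd := hS e (by simpa [hT] using he)
    induction e using Sym2.ind with | _ u v => ?_
    have huv : v ≠ u := fun h => hd (by simpa using h.symm)
    -- Flipping the color of one endpoint `u` reverses the sign of the edge's weight, so the
    -- colorings cancel in pairs.
    refine Finset.sum_involution (fun f _ => Function.update f u (!f u)) ?_ ?_
      (fun _ _ => Finset.mem_univ _) ?_
    · intro f _
      simp only [w, Sym2.map_mk, Sym2.mk_isDiag_iff, Function.update_self,
        Function.update_of_ne huv]
      cases f u <;> cases f v <;> simp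
    · intro f _ _ h
      have := congrFun h u
      simp at this
    · intro f _
      simp
  -- The constant coloring cuts nothing; its positive total forces a negative one elsewhere, which
  -- is what makes "more than half" strict.
  have hpos : 0 < ∑ e ∈ T, w (fun _ => true) e := by
    refine Finset.sum_pos (fun e _ => ?_) hTne
    induction e using Sym2.ind with | _ u v => simp [w]
  have hex : ∃ f, ∑ e ∈ T, w f e < 0 := by
    by_contra! hcon
    exact absurd hsum (Finset.sum_pos' (fun f _ => hcon f) ⟨_, Finset.mem_univ _, hpos⟩).ne'
  obtain ⟨f, hf⟩ := hex
  refine ⟨f, ?_⟩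
  have h1 : {e ∈ S | ¬ (e.map f).IsDiag} = ((T.filter fun e => ¬ (e.map f).IsDiag : Finset _) :
      Set (Sym2 V)) := by
    ext e
    simp [hT]
  have h2 : S.ncard = T.card := Set.ncard_eq_toFinset_card' S
  rw [h1, Set.ncard_coe_finset, h2]
  have h3 := Finset.card_filter_add_card_filter_not (s := T) fun e => (e.map f).IsDiag
  simp only [w, Finset.sum_ite, Finset.sum_const, nsmul_eq_mul, mul_one, mul_neg] at hf
  omega

theorem mem_edgeSet_cutGraph {V : Type*} {G : SimpleGraph V} {f : V → Bool} {e : Sym2 V} :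
    e ∈ (cutGraph G f).edgeSet ↔ e ∈ G.edgeSet ∧ ¬ (e.map f).IsDiag := by
  induction e using Sym2.ind with | _ u v => ?_
  rw [SimpleGraph.mem_edgeSet, cutGraph_adj]
  simp

/-- Colorings of the components combine into a coloring of the graph. -/
theorem exists_coloring_sum_le (t : G.ConnectedComponent → ℕ) [Fintype G.ConnectedComponent]
    (h : ∀ C, ∃ f : V → Bool, t C ≤ {e ∈ componentEdges G C | ¬ (e.map f).IsDiag}.ncard) :
    ∃ f : V → Bool, ∑ C, t C ≤ (cutGraph G f).edgeSet.ncard := by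
  classical
  have := Fintype.ofFinite V
  choose g hg using h
  let f : V → Bool := fun v => g (G.connectedComponentMk v) v
  refine ⟨f, ?_⟩
  let S : G.ConnectedComponent → Finset (Sym2 V) := fun C =>
    {e ∈ componentEdges G C | ¬ (e.map (g C)).IsDiag}.toFinset
  have hdisj : Set.PairwiseDisjoint (Finset.univ : Finset G.ConnectedComponent) S := by
    intro C _ D _ hCD
    refine Finset.disjoint_left.2 fun e heC heD => hCD ?_
    have h1 : e ∈ componentEdges G C := (Set.mem_toFinset.1 heC).1
    have h2 : e ∈ componentEdges G D := (Set.mem_toFinset.1 heD).1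
    induction e using Sym2.ind with | _ u v => ?_
    exact (mk_mem_componentEdges.1 h1).2.symm.trans (mk_mem_componentEdges.1 h2).2
  have hsub : ((Finset.univ.biUnion S : Finset (Sym2 V)) : Set (Sym2 V)) ⊆
      (cutGraph G f).edgeSet := by
    intro e he
    obtain ⟨C, -, he⟩ := Finset.mem_biUnion.1 (Finset.mem_coe.1 he)
    obtain ⟨he1, he2⟩ := Set.mem_toFinset.1 he
    refine mem_edgeSet_cutGraph.2 ⟨he1.1, ?_⟩
    convert he2 using 2
    refine Sym2.map_congr fun v hv => ?_
    have : G.connectedComponentMk v = C := he1.2 v hv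
    simp [f, this]
  calc ∑ C, t C ≤ ∑ C, (S C).card := Finset.sum_le_sum fun C _ => by
        rw [← Set.ncard_eq_toFinset_card']
        exact hg C
    _ = (Finset.univ.biUnion S).card := (Finset.card_biUnion hdisj).symm
    _ ≤ _ := by
        rw [← Set.ncard_coe_finset]
        exact Set.ncard_le_ncard hsub (Set.toFinite _)

theorem sum_ncard_supp [Fintype G.ConnectedComponent] :
    ∑ C : G.ConnectedComponent, C.supp.ncard = Nat.card V := by
  classical
  have := Fintype.ofFinite V
  rw [Nat.card_eq_fintype_card, ← Finset.card_univ,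
    Finset.card_eq_sum_card_fiberwise (f := G.connectedComponentMk) (t := Finset.univ)
      (fun _ _ => Finset.mem_univ _)]
  refine Finset.sum_congr rfl fun C _ => ?_
  rw [← Set.ncard_coe_finset]
  congr 1
  ext v
  simp

/-- A bipartition of a spanning forest cuts at least `|V| - c(G)` edges. -/
theorem exists_coloring_card_le :
    ∃ f : V → Bool, Nat.card V ≤ (cutGraph G f).edgeSet.ncard + numComponents G := by
  obtain ⟨F, hF, hac, h⟩ := exists_spanning_forest G
  let c := hac.coloringTwo
  refine ⟨fun v => decide (c v = 0), ?_⟩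
  rw [← h]
  refine Nat.add_le_add_right (Set.ncard_le_ncard (fun e he => ?_) (Set.toFinite _)) _
  refine mem_edgeSet_cutGraph.2 ⟨hF he, ?_⟩
  induction e using Sym2.ind with | _ u v => ?_
  have hadj : (SimpleGraph.fromEdgeSet F).Adj u v :=
    (SimpleGraph.fromEdgeSet_adj _).2 ⟨he, G.ne_of_adj (hF he)⟩
  have hc := c.valid hadj
  change c u ≠ c v at hc
  simp only [Sym2.map_mk, Sym2.mk_isDiag_iff, decide_eq_decide]
  omega

theorem two_le_ncard_supp {G : SimpleGraph V} (hiso : ∀ v : V, ¬ G.IsIsolated v)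
    (C : G.ConnectedComponent) : 2 ≤ C.supp.ncard := by
  induction C using SimpleGraph.ConnectedComponent.ind with | _ a => ?_
  have h := hiso a
  simp only [SimpleGraph.IsIsolated, not_forall, not_not] at h
  obtain ⟨b, hab⟩ := h
  exact (Set.one_lt_ncard (Set.toFinite _)).2
    ⟨a, rfl, b, SimpleGraph.ConnectedComponent.sound hab.reachable.symm, hab.ne⟩

/-- The component edges of a uniformly dense graph of density at least `k ≥ 2` have a cut
larger than a spanning tree by `k - 1`. -/
theorem exists_coloring_component {G : SimpleGraph V}
    (hiso : ∀ v : V, ¬ G.IsIsolated v) (hG : IsUniformlyDenseGraph G) {k : ℕ} (hk : 2 ≤ k)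
    (hkG : (k : ℝ) ≤ graphDensity G) (hne : G.edgeSet.Nonempty) (C : G.ConnectedComponent) :
    ∃ f : V → Bool, C.supp.ncard + k - 2 ≤
      {e ∈ componentEdges G C | ¬ (e.map f).IsDiag}.ncard := by
  have hs := two_le_ncard_supp hiso C
  have h1 := hG.le_ncard_componentEdges hne C
  have h2 := ncard_componentEdges_le G C
  obtain ⟨s, hs'⟩ : ∃ s, C.supp.ncard = s + 1 := ⟨C.supp.ncard - 1, by omega⟩
  rw [hs'] at h1 h2 hs ⊢
  have h3 : k * s ≤ (componentEdges G C).ncard := by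
    have h4 : (k : ℝ) * s ≤ graphDensity G * s := mul_le_mul_of_nonneg_right hkG (Nat.cast_nonneg _)
    push_cast at h1
    exact_mod_cast (by linarith : (k : ℝ) * s ≤ ((componentEdges G C).ncard : ℝ))
  have hpos : 0 < (componentEdges G C).ncard := lt_of_lt_of_le (Nat.mul_pos (by omega) (by omega)) h3
  obtain ⟨f, hf⟩ := exists_coloring_lt_two_mul_ncard
    (fun e he => G.not_isDiag_of_mem_edgeSet he.1) ((Set.ncard_pos (Set.toFinite _)).1 hpos)
  refine ⟨f, ?_⟩
  rw [Nat.choose_two_right, Nat.add_sub_cancel] at h2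
  -- Combines `k s ≤ m` with `m ≤ (s + 1) s / 2`, `m` being the number of edges of `C`.
  have h5 : 2 * k ≤ s + 1 := by
    have h6 : 2 * (k * s) ≤ (s + 1) * s := by omega
    exact Nat.le_of_mul_le_mul_right (by linarith) (by omega : 0 < s)
  -- For `k = 2`, strictness alone gives a cut of at least `s + 1`. For `k ≥ 3` the claim is `(k -
  -- 2) s ≥ 2k - 3`, and `s ≥ 2k - 1` reduces it to `(2k - 5)(k - 1) ≥ 0`.
  rcases hk.eq_or_lt with rfl | hk3
  · omega
  · have : 2 * (s + k - 1) ≤ k * s + 1 := by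
      zify [(by omega : 1 ≤ s + k)]
      zify at h5 hk3
      nlinarith
    omega

theorem exists_coloring_of_isUniformlyDenseGraph {G : SimpleGraph V}
    (hiso : ∀ v : V, ¬ G.IsIsolated v) (hG : IsUniformlyDenseGraph G)
    (hne : G.edgeSet.Nonempty) : ∃ f : V → Bool,
      (Nat.card V : ℤ) + (⌊graphDensity G⌋ - 2) * numComponents G ≤
        (cutGraph G f).edgeSet.ncard := by
  classical
  rcases le_or_gt ⌊graphDensity G⌋ 1 with h1 | h1
  -- Here the coefficient `⌊ρ⌋ - 2` is at most -1, so `|V| - c(G)` cut edges suffice.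
  · obtain ⟨f, hf⟩ := exists_coloring_card_le G
    refine ⟨f, ?_⟩
    zify at hf
    nlinarith [(numComponents G).cast_nonneg (α := ℤ)]
  · obtain ⟨k, hk⟩ := Int.eq_ofNat_of_zero_le (by omega : 0 ≤ ⌊graphDensity G⌋)
    have : Fintype G.ConnectedComponent := Fintype.ofFinite _
    have hk2 : 2 ≤ k := by omega
    have hkG : (k : ℝ) ≤ graphDensity G := by
      have := Int.floor_le (graphDensity G)
      rwa [hk, Int.cast_natCast] at this
    obtain ⟨f, hf⟩ := exists_coloring_sum_le G _
      (exists_coloring_component hiso hG hk2 hkG hne)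
    refine ⟨f, le_trans (le_of_eq ?_) (Nat.cast_le.2 hf)⟩
    rw [hk, ← sum_ncard_supp G, numComponents, Nat.card_eq_fintype_card, Nat.cast_sum,
      Nat.cast_sum, ← Finset.card_univ, mul_comm, ← nsmul_eq_mul, ← Finset.sum_const,
      ← Finset.sum_add_distrib]
    refine Finset.sum_congr rfl fun C _ => ?_
    omega

end

/-! ### Conclusion -/

theorem mainTheorem12 {V : Type*} [Fintype V] [Nonempty V] (G : SimpleGraph V)
    [DecidableRel G.Adj] (hiso : ∀ v : V, ¬ G.IsIsolated v) (hG : IsUniformlyDenseGraph G) :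
    IsGreatest {μ : ℝ | Module.End.HasEigenvalue (normalizedLaplacian G) μ} (lambdaMax G) ∧
    lambdaMax G ≥ 2 * (graphDensity G)⁻¹ +
      2 * ((((⌊graphDensity G⌋ : ℤ) : ℝ) - 1) * (numComponents G : ℝ)) / (G.edgeSet.ncard : ℝ) := by
  have hadj : ∀ v, ∃ w, G.Adj v w := fun v => by
    simpa only [SimpleGraph.IsIsolated, not_forall, not_not] using hiso v
  have hdeg : ∀ v, 0 < G.degree v := fun v => (G.degree_pos_iff_exists_adj v).2 (hadj v)
  obtain ⟨w, hw⟩ := hadj (Classical.arbitrary V)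
  have hne : G.edgeSet.Nonempty := ⟨_, G.mem_edgeSet.2 hw⟩
  obtain ⟨f, hf⟩ := exists_coloring_of_isUniformlyDenseGraph hiso hG hne
  obtain ⟨μ, hμ, hle⟩ := exists_hasEigenvalue_ge_cut G hdeg f
  have hgr := isGreatest_lambdaMax G hμ
  refine ⟨hgr, le_trans (le_trans ?_ hle) (hgr.2 hμ)⟩
  have hr : (((cycleMatroid G).eRk G.edgeSet).toNat : ℝ) + numComponents G = Nat.card V := by
    exact_mod_cast rank_edgeSet_add_numComponents G
  have hinv : (graphDensity G)⁻¹ =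
      (((cycleMatroid G).eRk G.edgeSet).toNat : ℝ) / G.edgeSet.ncard := inv_div _ _
  have hf' : (Nat.card V : ℝ) + ((⌊graphDensity G⌋ : ℝ) - 2) * numComponents G ≤
      (cutGraph G f).edgeSet.ncard := by exact_mod_cast hf
  rw [hinv, ← mul_div_assoc, ← add_div]
  refine div_le_div_of_nonneg_right ?_ (Nat.cast_nonneg _)
  linarith
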